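/- Two servers process status updates, each of which needs step 1 followed by step 2. Let $\mu_1,\mu_2>0$, $\rho=\mu_1/\mu_2$ and $\alpha\in\mathbb R$. Under the Parallel Shared Intermediate Update (P-SIU) policy both servers always execute the same step of the same update; as soon as one of them completes step 1, it shares the result and both start step 2 of that update; as soon as one of them completes step 2, the update is delivered to the monitor and both start step 1 of a fresh (age $0$) update. The execution times of the two servers in all the steps are independent, those of step $i$ being exponential with rate $\mu_i$. Let $q(t)\in\{1,2\}$ be the step in progress at time $t$, $x_0(t)$ the age at the monitor, and $x_1(t)$ the age of the update in service: both ages grow at unit rate, the completion of step 1 leaves them unchanged, and the completion of step 2 replaces $(x_0,x_1)$ by $(x_1,0)$. The initial step $q(0)\in\{1,2\}$ and the initial ages $x_0(0),x_1(0)\ge 0$ are arbitrary constants. Then: 1. The system acts like a single server with step rates $2\mu_1$ and $2\mu_2$: the durations of the successive steps are independent, and every duration of a step $i$ is exponential with rate $2\mu_i$. 2. $x_0(t)$ is integrable for every $t\ge 0$, and the average age at the monitor is $$\Delta_{\text{P-SIU}}=\lim_{t\to\infty}\mathbb E[x_0(t)]=\frac1{\mu_2}\Bigl[1+\frac1{2\rho}\Bigl(1+\frac1{1+\rho}\Bigr)\Bigr].$$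 3. The Markov chain on $\{1,2\}$ with transitions $1\to2$ at rate $2\mu_1$ and $2\to1$ at rate $2\mu_2$ has exactly one stationary distribution, namely $\pi_1=\frac1{1+\rho}$, $\pi_2=\frac\rho{1+\rho}$, and $\lim_{t\to\infty}\mathbb P(q(t)=q)=\pi_q$ for $q=1,2$. With $n_{q,i}$ the number of servers that execute step $i$ in state $q$, and $\bar N_i(\rho)=\sum_q\pi_q n_{q,i}$, the power-weighted processor activity is $$\bar N(\rho)=\rho^\alpha\bar N_1(\rho)+\bar N_2(\rho)=\frac{2(\rho^\alpha+\rho)}{1+\rho}.$$ 4. The age balance equations $$2\mu_1(v_{10},v_{11})=\pi_1(1,1)+2\mu_2(v_{21},0),\qquad 2\mu_2(v_{20},v_{21})=\pi_2(1,1)+2\mu_1(v_{10},v_{11})$$ have exactly one solution; it is nonnegative, and $v_{10}+v_{20}=\Delta_{\text{P-SIU}}$. -/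

import Mathlib

open MeasureTheory ProbabilityTheory Filter Topology

/-! Steps of an update are indexed by `Fin 2`: `0` is step 1 and `1` is step 2. The same indices
name the discrete states of the system (which step is being executed) and the two servers. -/

/-! ### Stochastic hybrid systems with unit-rate ages -/

/-- The data of a stochastic hybrid system for age analysis: a finite set `L` of transitions between
the discrete states `Q`, each with a rate and a linear reset map acting on row vectors, `x ↦ x A`. -/
structure AgeSHS (Q L ι : Type) where
  src : L → Q
  dst : L → Q
  rate : L → ℝ
  reset : L → Matrix ι ι ℝ

/-- `π` is a stationary distribution of the continuous-time Markov chain of the discrete state. -/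
def AgeSHS.IsStationary {Q L ι : Type} [Fintype Q] [Fintype L] [DecidableEq Q]
    (H : AgeSHS Q L ι) (π : Q → ℝ) : Prop :=
  (∀ q, 0 ≤ π q) ∧ ∑ q, π q = 1 ∧
    ∀ q, π q * (∑ l, if H.src l = q then H.rate l else 0) =
      ∑ l, if H.dst l = q then H.rate l * π (H.src l) else 0

/-- The age balance equations: for every state `q`,
`v_q * (total rate out of q) = π_q * (1, …, 1) + ∑ rate_l * v_{src l} A_l`, the sum being over the
transitions `l` into `q`. -/
def AgeSHS.AgeBalance {Q L ι : Type} [Fintype L] [Fintype ι] [DecidableEq Q]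
    (H : AgeSHS Q L ι) (π : Q → ℝ) (v : Q → ι → ℝ) : Prop :=
  ∀ q, (∑ l, if H.src l = q then H.rate l else 0) • v q = π q • (1 : ι → ℝ) +
    ∑ l, if H.dst l = q then H.rate l • Matrix.vecMul (v (H.src l)) (H.reset l) else 0

/-- The P-SIU hybrid system with age vector `(x₀, x₁)`. Transition `0`: step 1 to step 2
at rate `2 μ₁` with `x' = (x₀, x₁)`. Transition `1`: step 2 to step 1 at rate `2 μ₂` with
`x' = (x₁, 0)`. -/
def psiuSHS (μ₁ μ₂ : ℝ) : AgeSHS (Fin 2) (Fin 2) (Fin 2) where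
  src := ![0, 1]
  dst := ![1, 0]
  rate := ![2 * μ₁, 2 * μ₂]
  reset := ![!![1, 0; 0, 1], !![0, 0; 1, 0]]

/-! ### Power-weighted processor activity -/

/-- The step executed by server `s` in state `q` under P-SIU: both servers execute step `q`. -/
def psiuServerStep (q : Fin 2) (_s : Fin 2) : Fin 2 := q

/-- The number of servers that execute step `i` in state `q` under P-SIU. -/
def psiuNumWorking (q i : Fin 2) : ℕ := Finset.card {s : Fin 2 | psiuServerStep q s = i}

/-- The average number of servers that execute step `i`, when state `q` has probability `π q` and
`n q i` servers execute step `i` in state `q`. -/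
def avgWorking (π : Fin 2 → ℝ) (n : Fin 2 → Fin 2 → ℕ) (i : Fin 2) : ℝ :=
  ∑ q, π q * (n q i : ℝ)

/-- The power-weighted processor activity: `ρ ^ α` times the average number of servers on step 1,
plus the average number of servers on step 2. -/
noncomputable def pwpa (α ρ : ℝ) (π : Fin 2 → ℝ) (n : Fin 2 → Fin 2 → ℕ) : ℝ :=
  ρ ^ α * avgWorking π n 0 + avgWorking π n 1

/-! ### Sample paths

The system passes through phases `0, 1, 2, …`. In each phase one step of one update is executed;
steps 1 and 2 alternate, starting from `q₀`. -/

/-- The step executed in phase `n`. -/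
def phaseStep (q₀ : Fin 2) : ℕ → Fin 2
  | 0 => q₀
  | n + 1 => phaseStep q₀ n + 1

/-- The effect on the ages `x = (x₀, x₁)` (at the monitor, of the update in service) of completing
a step. Completing step 1 changes no age; completing step 2 delivers the update to the monitor and
starts a fresh update. -/
def completeStep (q : Fin 2) (x : Fin 2 → ℝ) : Fin 2 → ℝ :=
  if q = 0 then x else ![x 1, 0]

/-- The time at which phase `n` starts, when phase `k` lasts `d k`. -/
def phaseStart (d : ℕ → ℝ) (n : ℕ) : ℝ := ∑ k ∈ Finset.range n, d k

/-- The ages at the start of phase `n`, when the ages at time `0` are `a`. -/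
def ageAtPhase (q₀ : Fin 2) (a : Fin 2 → ℝ) (d : ℕ → ℝ) : ℕ → Fin 2 → ℝ
  | 0 => a
  | n + 1 => completeStep (phaseStep q₀ n) (fun j => ageAtPhase q₀ a d n j + d n)

/-- The index of the phase in progress at time `t`. -/
noncomputable def phaseAt (d : ℕ → ℝ) (t : ℝ) : ℕ := sSup {n : ℕ | phaseStart d n ≤ t}

/-- The step in progress at time `t`. -/
noncomputable def stateAt (q₀ : Fin 2) (d : ℕ → ℝ) (t : ℝ) : Fin 2 := phaseStep q₀ (phaseAt d t)

/-- The ages `(x₀(t), x₁(t))` at time `t`; within a phase they grow at unit rate. -/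
noncomputable def agesAt (q₀ : Fin 2) (a : Fin 2 → ℝ) (d : ℕ → ℝ) (t : ℝ) (j : Fin 2) : ℝ :=
  ageAtPhase q₀ a d (phaseAt d t) j + (t - phaseStart d (phaseAt d t))

/-! ### P-SIU -/

/-- `T n s` is the time that server `s`, left alone, would need for the step that both servers
start at the beginning of phase `n`. All these times are independent, and those of step `i` are
exponential with rate `μᵢ`. -/
structure IsPSIUExecutionTimes {Ω : Type*} [MeasurableSpace Ω] (P : Measure Ω) (μ₁ μ₂ : ℝ)
    (q₀ : Fin 2) (T : ℕ → Fin 2 → Ω → ℝ) : Prop where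
  measurable : ∀ n s, Measurable (T n s)
  indep : iIndepFun (fun p : ℕ × Fin 2 => T p.1 p.2) P
  law : ∀ n s, HasLaw (T n s) (expMeasure (![μ₁, μ₂] (phaseStep q₀ n))) P

/-- Under P-SIU a phase ends as soon as one of the two servers completes the step: its result is
shared, and both servers move on together. -/
def psiuDuration {Ω : Type*} (T : ℕ → Fin 2 → Ω → ℝ) (ω : Ω) (n : ℕ) : ℝ :=
  min (T n 0 ω) (T n 1 ω)

/-! ### Exponential laws and independence of minima -/

/-! The minimum of two independent exponentials is exponential with the sum of the rates, and
disjoint blocks of an independent family are independent. So the phases have independent exponential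
durations of rates `2 * μ₁` and `2 * μ₂`.

Everything that depends on time comes from a backward equation. Let `F q τ x` be continuous, equal
to a payoff `h` at `τ = 0`, and satisfy `dF/ds = r q * (F - F after completing step q)` along the
ageing line `s ↦ (τ - s, x + s)`. Integrating against `exp (-(r q * s))` gives the first-step
identity: `F` is what conditioning on the end of the current phase yields. Hence the payoff
collected before phase `n` plus the value `F` at its start has an expectation independent of `n`,
namely `F q₀ t a`. Almost surely the phases do not accumulate, and up to time `t` the ages stay in a
compact box, so dominated convergence identifies `F q₀ t a` with the expected payoff
(`IsBackwardSolution.integrable_and_integral_eq`).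

Two explicit solutions suffice. The payoff "step `k` is in progress" gives `stepProb`. The payoff `x
0` gives `expectedAge`, affine in the ages: its coefficients solve a triangular linear system, and
its constant terms a coupled pair that a sum and a difference decouple. Their limits give the
stationary probabilities and the average age. Stationarity and age balance are small linear systems,
solved directly. -/

lemma expMeasure_real_Ioi {r : ℝ} (hr : 0 < r) {x : ℝ} (hx : 0 ≤ x) :
    (expMeasure r).real (Set.Ioi x) = Real.exp (-(r * x)) := by
  have := isProbabilityMeasure_expMeasure hr
  have h := cdf_expMeasure_eq hr x
  rw [if_pos hx, cdf_eq_real] at h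
  rw [← Set.compl_Iic, probReal_compl_eq_one_sub measurableSet_Iic, h]
  ring

lemma expMeasure_real_Ioi_of_neg {r : ℝ} (hr : 0 < r) {x : ℝ} (hx : x < 0) :
    (expMeasure r).real (Set.Ioi x) = 1 := by
  have := isProbabilityMeasure_expMeasure hr
  have h := cdf_expMeasure_eq hr x
  rw [if_neg (not_le.2 hx), cdf_eq_real] at h
  rw [← Set.compl_Iic, probReal_compl_eq_one_sub measurableSet_Iic, h]
  ring

lemma ae_nonneg_of_hasLaw_expMeasure {Ω : Type*} [MeasurableSpace Ω] {P : Measure Ω} {r : ℝ}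
    (hr : 0 < r) {X : Ω → ℝ} (hX : HasLaw X (expMeasure r) P) : ∀ᵐ ω ∂P, 0 ≤ X ω := by
  have := isProbabilityMeasure_expMeasure hr
  rw [hX.ae_iff (p := fun x => 0 ≤ x) (measurableSet_Ici.mem)]
  rw [ae_iff, expMeasure, gammaMeasure]
  have : {a : ℝ | ¬ 0 ≤ a} = Set.Iio 0 := by ext; simp
  rw [this, withDensity_apply _ measurableSet_Iio]
  exact lintegral_exponentialPDF_of_nonpos le_rfl

lemma integral_expMeasure {r : ℝ} (hr : 0 < r) (f : ℝ → ℝ) :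
    ∫ x, f x ∂expMeasure r = ∫ x in Set.Ioi 0, r * Real.exp (-(r * x)) * f x := by
  rw [expMeasure, gammaMeasure]
  change ∫ x, f x ∂(volume.withDensity (exponentialPDF r)) = _
  rw [integral_withDensity_eq_integral_toReal_smul (f := exponentialPDF r)
    (measurable_exponentialPDFReal r).ennreal_ofReal (by simp [exponentialPDF]),
    ← integral_Ici_eq_integral_Ioi, ← integral_indicator measurableSet_Ici]
  refine integral_congr_ae (Eventually.of_forall fun x => ?_)
  by_cases hx : 0 ≤ x
  · have : 0 ≤ r * Real.exp (-(r * x)) := by positivity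
    simp [Set.indicator, hx, exponentialPDF_eq, ENNReal.toReal_ofReal this]
  · simp [Set.indicator, hx, exponentialPDF_eq]

/-- By independence the survival functions multiply, which adds the rates; the distribution function
determines the law. -/
lemma hasLaw_min_expMeasure {Ω : Type*} [MeasurableSpace Ω] {P : Measure Ω}
    [IsProbabilityMeasure P] {r s : ℝ} (hr : 0 < r) (hs : 0 < s) {X Y : Ω → ℝ}
    (hX : HasLaw X (expMeasure r) P) (hY : HasLaw Y (expMeasure s) P) (hXY : IndepFun X Y P) :
    HasLaw (fun ω => min (X ω) (Y ω)) (expMeasure (r + s)) P := by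
  have hm : AEMeasurable (fun ω => min (X ω) (Y ω)) P := hX.aemeasurable.min hY.aemeasurable
  refine ⟨hm, ?_⟩
  have := isProbabilityMeasure_expMeasure (add_pos hr hs)
  have := Measure.isProbabilityMeasure_map hm
  have key : ∀ x, (P.map fun ω => min (X ω) (Y ω)).real (Set.Ioi x) =
      (expMeasure r).real (Set.Ioi x) * (expMeasure s).real (Set.Ioi x) := by
    intro x
    rw [map_measureReal_apply_of_aemeasurable hm measurableSet_Ioi]
    have : (fun ω => min (X ω) (Y ω)) ⁻¹' Set.Ioi x = X ⁻¹' Set.Ioi x ∩ Y ⁻¹' Set.Ioi x := by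
      ext; simp
    rw [this, Measure.real, hXY.measure_inter_preimage_eq_mul _ _ measurableSet_Ioi
      measurableSet_Ioi, ENNReal.toReal_mul]
    exact congrArg₂ _ (hX.measureReal_eq (p := fun y => x < y) measurableSet_Ioi)
      (hY.measureReal_eq (p := fun y => x < y) measurableSet_Ioi)
  refine Measure.eq_of_cdf _ _ ?_
  ext x
  rw [cdf_eq_real, cdf_eq_real, ← Set.compl_Ioi, probReal_compl_eq_one_sub measurableSet_Ioi,
    probReal_compl_eq_one_sub measurableSet_Ioi, key]
  rcases lt_or_ge x 0 with hx | hx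
  · simp [expMeasure_real_Ioi_of_neg, hx, hr, hs, add_pos hr hs]
  · rw [expMeasure_real_Ioi hr hx, expMeasure_real_Ioi hs hx,
      expMeasure_real_Ioi (add_pos hr hs) hx, ← Real.exp_add]
    ring_nf

/-- Independence says that the joint law is a product measure, and currying a product over `ι × κ`
gives a product over `ι` of products over `κ`. -/
lemma iIndepFun_curry {Ω ι κ 𝓧 : Type*} [MeasurableSpace Ω] [MeasurableSpace 𝓧] {P : Measure Ω}
    [IsProbabilityMeasure P] {X : ι → κ → Ω → 𝓧} (hm : ∀ i j, Measurable (X i j))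
    (h : iIndepFun (fun p : ι × κ => X p.1 p.2) P) : iIndepFun (fun i ω j => X i j ω) P := by
  have hp : ∀ i j, IsProbabilityMeasure (P.map (X i j)) :=
    fun i j => Measure.isProbabilityMeasure_map (hm i j).aemeasurable
  have h1 := h.map_fun_eq_infinitePi_map (fun p : ι × κ => hm p.1 p.2)
  have h2 := Measure.infinitePi_map_curry (fun i j => P.map (X i j))
  rw [← h1, Measure.map_map (MeasurableEquiv.measurable _)
    (measurable_pi_lambda _ fun p : ι × κ => hm p.1 p.2)] at h2
  have hm' : ∀ i, Measurable fun ω j => X i j ω := fun i => measurable_pi_lambda _ (hm i)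
  rw [iIndepFun_iff_map_fun_eq_infinitePi_map hm']
  refine h2.trans ?_
  congr 1
  ext1 i
  have h3 : iIndepFun (X i) P := h.precomp (g := fun j => (i, j)) (fun a b hab => by simpa using hab)
  exact (h3.map_fun_eq_infinitePi_map (hm i)).symm

/-! ### The sequence of phases -/

lemma phaseStart_succ (d : ℕ → ℝ) (n : ℕ) : phaseStart d (n + 1) = phaseStart d n + d n :=
  Finset.sum_range_succ _ _

lemma phaseStart_mono {d : ℕ → ℝ} (hd : ∀ n, 0 ≤ d n) : Monotone (phaseStart d) :=
  monotone_nat_of_le_succ fun n => by rw [phaseStart_succ]; linarith [hd n]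

/-- Here the set in `phaseAt` is exactly `Set.Iic n`, so its `sSup` is a genuine maximum and not the
default value of an unbounded set. -/
lemma phaseAt_eq {d : ℕ → ℝ} (hd : ∀ n, 0 ≤ d n) {t : ℝ} {n : ℕ} (h1 : phaseStart d n ≤ t)
    (h2 : t < phaseStart d (n + 1)) : phaseAt d t = n := by
  have : {k : ℕ | phaseStart d k ≤ t} = Set.Iic n := by
    ext k
    simp only [Set.mem_ofPred_eq, Set.mem_Iic]
    refine ⟨fun hk => ?_, fun hk => (phaseStart_mono hd hk).trans h1⟩
    by_contra hkn
    exact absurd ((phaseStart_mono hd (by omega : n + 1 ≤ k)).trans hk) (not_le.2 h2)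
  rw [phaseAt, this, csSup_Iic]

lemma ageAtPhase_nonneg {q₀ : Fin 2} {a : Fin 2 → ℝ} {d : ℕ → ℝ} (ha : ∀ j, 0 ≤ a j)
    (hd : ∀ n, 0 ≤ d n) (n : ℕ) (j : Fin 2) : 0 ≤ ageAtPhase q₀ a d n j := by
  induction n generalizing j with
  | zero => exact ha j
  | succ n ih =>
    rw [ageAtPhase, completeStep]
    split_ifs
    · exact add_nonneg (ih j) (hd n)
    · fin_cases j
      · exact add_nonneg (ih 1) (hd n)
      · simp

/-- A reset only copies an existing age or inserts `0`, so the largest age never grows faster than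
time. This confines the ages to a compact box. -/
lemma ageAtPhase_le {q₀ : Fin 2} {a : Fin 2 → ℝ} {d : ℕ → ℝ} {M : ℝ} (ha : ∀ j, 0 ≤ a j)
    (hM : ∀ j, a j ≤ M) (hd : ∀ n, 0 ≤ d n) (n : ℕ) (j : Fin 2) :
    ageAtPhase q₀ a d n j ≤ M + phaseStart d n := by
  induction n generalizing j with
  | zero => simpa [ageAtPhase, phaseStart] using hM j
  | succ n ih =>
    rw [ageAtPhase, completeStep, phaseStart_succ]
    split_ifs
    · linarith [ih j]
    · fin_cases j
      · change ageAtPhase q₀ a d n 1 + d n ≤ _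
        linarith [ih 1]
      · have h1 := phaseStart_mono hd (Nat.zero_le n)
        have h2 : phaseStart d 0 = 0 := by simp [phaseStart]
        simp only [Fin.mk_one, Matrix.cons_val_one, Matrix.cons_val_fin_one]
        linarith [(ha 0).trans (hM 0), hd n]

lemma phaseStart_congr {d d' : ℕ → ℝ} {n : ℕ} (h : ∀ k < n, d k = d' k) :
    phaseStart d n = phaseStart d' n :=
  Finset.sum_congr rfl fun k hk => h k (Finset.mem_range.1 hk)

lemma ageAtPhase_congr {q₀ : Fin 2} {a : Fin 2 → ℝ} {d d' : ℕ → ℝ} {n : ℕ}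
    (h : ∀ k < n, d k = d' k) : ageAtPhase q₀ a d n = ageAtPhase q₀ a d' n := by
  induction n with
  | zero => rfl
  | succ n ih =>
    rw [ageAtPhase, ageAtPhase, ih fun k hk => h k (by omega), h n (by omega)]

lemma continuous_completeStep (q : Fin 2) : Continuous (completeStep q) := by
  unfold completeStep
  split_ifs
  · exact continuous_id
  · refine continuous_pi fun j => ?_
    fin_cases j
    · exact continuous_apply 1
    · exact continuous_const

lemma measurable_phaseStart {Ω : Type*} [MeasurableSpace Ω] {D : ℕ → Ω → ℝ}
    (hD : ∀ n, Measurable (D n)) (n : ℕ) : Measurable fun ω => phaseStart (D · ω) n :=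
  Finset.measurable_sum _ fun k _ => hD k

lemma measurable_ageAtPhase {Ω : Type*} [MeasurableSpace Ω] {D : ℕ → Ω → ℝ}
    (hD : ∀ n, Measurable (D n)) (q₀ : Fin 2) (a : Fin 2 → ℝ) (n : ℕ) :
    Measurable fun ω => ageAtPhase q₀ a (D · ω) n := by
  induction n with
  | zero => exact measurable_const
  | succ n ih =>
    exact (continuous_completeStep _).measurable.comp
      (measurable_pi_lambda _ fun j => ((measurable_pi_apply j).comp ih).add (hD n))

/-- The state at the start of a phase does not depend on the duration of that phase. -/
lemma indepFun_phaseStart_ageAtPhase {Ω : Type*} [MeasurableSpace Ω] {P : Measure Ω}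
    {D : ℕ → Ω → ℝ} (hD : ∀ n, Measurable (D n)) (hi : iIndepFun D P) (q₀ : Fin 2)
    (a : Fin 2 → ℝ) (n : ℕ) :
    IndepFun (fun ω => (phaseStart (D · ω) n, ageAtPhase q₀ a (D · ω) n)) (D n) P := by
  have h := hi.indepFun_finset (Finset.range n) {n} (by simp) hD
  -- Rebuilds a full duration sequence from the first `n` durations by padding with zeros; the start
  -- of phase `n` and its ages see nothing else.
  let e : ℕ → (Finset.range n → ℝ) → ℝ := fun k v => if hk : k ∈ Finset.range n then v ⟨k, hk⟩ else 0
  have he : ∀ k, Measurable (e k) := fun k => by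
    by_cases hk : k ∈ Finset.range n
    · simpa only [e, dif_pos hk] using measurable_pi_apply _
    · simp only [e, dif_neg hk, measurable_const]
  have h' := h.comp ((measurable_phaseStart he n).prodMk (measurable_ageAtPhase he q₀ a n))
    (measurable_pi_apply (⟨n, by simp⟩ : ({n} : Finset ℕ)))
  have hk : ∀ ω, ∀ k < n, D k ω = e k (fun i : Finset.range n => D i ω) := fun ω k hk => by
    simp [e, hk]
  convert h' using 1
  swap
  · rfl
  ext1 ω
  exact Prod.ext (phaseStart_congr (hk ω)) (ageAtPhase_congr (hk ω))

/-- Phases with independent exponential durations of bounded mean do not accumulate. -/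
lemma ae_exists_lt_phaseStart {Ω : Type*} [MeasurableSpace Ω] {P : Measure Ω}
    [IsProbabilityMeasure P] {D : ℕ → Ω → ℝ} (hD : ∀ n, Measurable (D n)) (hi : iIndepFun D P)
    {r : ℕ → ℝ} {R : ℝ} (hr : ∀ n, 0 < r n) (hR : ∀ n, r n ≤ R)
    (hlaw : ∀ n, HasLaw (D n) (expMeasure (r n)) P) :
    ∀ᵐ ω ∂P, ∀ t, ∃ n, t < phaseStart (D · ω) n := by
  have hs : ∀ n, MeasurableSet (D n ⁻¹' Set.Ioi 1) := fun n => hD n measurableSet_Ioi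
  have hind : iIndepSet (fun n => D n ⁻¹' Set.Ioi 1) P := by
    rw [iIndepSet_iff_meas_biInter hs]
    exact fun s => hi.meas_biInter fun i _ => ⟨_, measurableSet_Ioi, rfl⟩
  -- Bounded rates keep the probability of a phase longer than 1 away from zero, so the second
  -- Borel–Cantelli lemma gives infinitely many such phases, each adding at least 1 to the elapsed
  -- time.
  have hlow : ∀ n, ENNReal.ofReal (Real.exp (-R)) ≤ P (D n ⁻¹' Set.Ioi 1) := fun n => by
    have := isProbabilityMeasure_expMeasure (hr n)
    have h1 : P (D n ⁻¹' Set.Ioi 1) = expMeasure (r n) (Set.Ioi 1) :=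
      (hlaw n).measure_eq (p := fun y => 1 < y) measurableSet_Ioi
    rw [h1, ← ofReal_measureReal, expMeasure_real_Ioi (hr n) zero_le_one]
    exact ENNReal.ofReal_le_ofReal (Real.exp_le_exp.2 (by linarith [hR n]))
  have hsum : ∑' n, P (D n ⁻¹' Set.Ioi 1) = ⊤ := by
    refine top_le_iff.1 (le_trans (le_of_eq ?_) (ENNReal.tsum_le_tsum hlow))
    rw [ENNReal.tsum_const_eq_top_of_ne_zero]
    simp [Real.exp_pos]
  have h1 := measure_limsup_eq_one hs hind hsum
  have h2 : ∀ᵐ ω ∂P, ω ∈ limsup (fun n => D n ⁻¹' Set.Ioi 1) atTop :=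
    (prob_compl_eq_zero_iff (MeasurableSet.measurableSet_limsup hs)).2 h1
  have h3 : ∀ᵐ ω ∂P, ∀ n, 0 ≤ D n ω :=
    ae_all_iff.2 fun n => ae_nonneg_of_hasLaw_expMeasure (hr n) (hlaw n)
  filter_upwards [h2, h3] with ω h2 h3
  rw [mem_limsup_iff_frequently_mem, frequently_atTop] at h2
  have key : ∀ m : ℕ, ∃ n, (m : ℝ) ≤ phaseStart (D · ω) n := by
    intro m
    induction m with
    | zero => exact ⟨0, by simp [phaseStart]⟩
    | succ m ih =>
      obtain ⟨n, hn⟩ := ih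
      obtain ⟨k, hk, hk1⟩ := h2 n
      refine ⟨k + 1, ?_⟩
      have := phaseStart_mono h3 hk
      simp only [Set.mem_preimage, Set.mem_Ioi] at hk1
      rw [phaseStart_succ]
      push_cast
      linarith
  intro t
  obtain ⟨m, hm⟩ := exists_nat_gt t
  obtain ⟨n, hn⟩ := key m
  exact ⟨n, hm.trans_le hn⟩

/-! ### The backward equation -/

/-- `F q τ x` solves the backward equation of the alternating-step system with rates `r`: the
expectation, a time `τ` after a phase of step `q` starts with ages `x`, of the payoff `h`. -/
structure IsBackwardSolution (r : Fin 2 → ℝ) (h : Fin 2 → (Fin 2 → ℝ) → ℝ)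
    (F : Fin 2 → ℝ → (Fin 2 → ℝ) → ℝ) : Prop where
  continuous : ∀ q, Continuous fun p : ℝ × (Fin 2 → ℝ) => F q p.1 p.2
  init : ∀ q x, F q 0 x = h q x
  hasDerivAt : ∀ (q : Fin 2) (τ : ℝ) (x : Fin 2 → ℝ) (s : ℝ), HasDerivAt (fun s => F q (τ - s) (fun j => x j + s))
    (r q * (F q (τ - s) (fun j => x j + s) -
      F (q + 1) (τ - s) (completeStep q fun j => x j + s))) s

namespace IsBackwardSolution

variable {r : Fin 2 → ℝ} {h : Fin 2 → (Fin 2 → ℝ) → ℝ} {F : Fin 2 → ℝ → (Fin 2 → ℝ) → ℝ}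

lemma continuous_payoff (hF : IsBackwardSolution r h F) (q : Fin 2) : Continuous (h q) := by
  have : h q = fun x => F q 0 x := funext fun x => (hF.init q x).symm
  rw [this]
  exact (hF.continuous q).comp (continuous_const.prodMk continuous_id)

lemma continuous_kernel (hF : IsBackwardSolution r h F) (q : Fin 2) (τ : ℝ) (x : Fin 2 → ℝ) :
    Continuous fun s => r q * Real.exp (-(r q * s)) *
      F (q + 1) (τ - s) (completeStep q fun j => x j + s) := by
  have h1 : Continuous fun s : ℝ => (τ - s, completeStep q fun j => x j + s) :=
    (by fun_prop : Continuous fun s : ℝ => τ - s).prodMk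
      ((continuous_completeStep q).comp (by fun_prop))
  exact (by fun_prop : Continuous fun s : ℝ => r q * Real.exp (-(r q * s))).mul
    ((hF.continuous (q + 1)).comp h1)

/-- The integrand is the derivative of `-exp (-(r q * s)) * F` along the ageing line; the endpoint
`s = τ` contributes the payoff. -/
lemma intervalIntegral_eq (hF : IsBackwardSolution r h F) (q : Fin 2) (τ : ℝ) (x : Fin 2 → ℝ) :
    ∫ s in (0 : ℝ)..τ, r q * Real.exp (-(r q * s)) *
        F (q + 1) (τ - s) (completeStep q fun j => x j + s) =
      F q τ x - Real.exp (-(r q * τ)) * h q (fun j => x j + τ) := by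
  have hc := hF.continuous_kernel q τ x
  have hd : ∀ s ∈ Set.uIcc 0 τ, HasDerivAt
      (fun s => -(Real.exp (-(r q * s)) * F q (τ - s) (fun j => x j + s)))
      (r q * Real.exp (-(r q * s)) * F (q + 1) (τ - s) (completeStep q fun j => x j + s)) s := by
    intro s _
    have h1 : HasDerivAt (fun s => Real.exp (-(r q * s))) (Real.exp (-(r q * s)) * (-(r q))) s := by
      simpa using (((hasDerivAt_id s).const_mul (r q)).neg).exp
    refine (h1.mul (hF.hasDerivAt q τ x s)).neg.congr_deriv ?_
    ring
  rw [intervalIntegral.integral_eq_sub_of_hasDerivAt hd (hc.intervalIntegrable _ _)]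
  simp [hF.init]
  ring

/-- The first-step identity: either the phase outlasts `τ` and the payoff is read off, or it ends at
`y ≤ τ` and the process restarts in the next step with `τ - y` left. -/
lemma integral_expMeasure_eq (hF : IsBackwardSolution r h F) {q : Fin 2} (hr : 0 < r q) {τ : ℝ}
    (hτ : 0 ≤ τ) (x : Fin 2 → ℝ) :
    ∫ y, (if τ < y then h q (fun j => x j + τ) else
      F (q + 1) (τ - y) (completeStep q fun j => x j + y)) ∂expMeasure (r q) = F q τ x := by
  have hc := hF.continuous_kernel q τ x
  have hexp : IntegrableOn (fun y => Real.exp (-(r q) * y)) (Set.Ioi τ) :=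
    exp_neg_integrableOn_Ioi τ hr
  rw [integral_expMeasure hr, ← Set.Ioc_union_Ioi_eq_Ioi hτ]
  have e1 : Set.EqOn (fun y => r q * Real.exp (-(r q * y)) * (if τ < y then
      h q (fun j => x j + τ) else F (q + 1) (τ - y) (completeStep q fun j => x j + y)))
      (fun y => r q * Real.exp (-(r q * y)) *
        F (q + 1) (τ - y) (completeStep q fun j => x j + y)) (Set.Ioc 0 τ) := fun y hy => by
    simp only [if_neg (not_lt.2 hy.2)]
  have e2 : Set.EqOn (fun y => r q * Real.exp (-(r q * y)) * (if τ < y then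
      h q (fun j => x j + τ) else F (q + 1) (τ - y) (completeStep q fun j => x j + y)))
      (fun y => (r q * h q (fun j => x j + τ)) * Real.exp (-(r q) * y)) (Set.Ioi τ) :=
    fun y hy => by
      simp only [if_pos (Set.mem_Ioi.1 hy), neg_mul]
      ring
  rw [setIntegral_union (Set.Ioc_disjoint_Ioi le_rfl) measurableSet_Ioi
    ((integrableOn_congr_fun e1 measurableSet_Ioc).2
      (hc.integrableOn_Icc.mono_set Set.Ioc_subset_Icc_self))
    ((integrableOn_congr_fun e2 measurableSet_Ioi).2 (hexp.const_mul _)),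
    setIntegral_congr_fun measurableSet_Ioc e1, setIntegral_congr_fun measurableSet_Ioi e2,
    ← intervalIntegral.integral_of_le hτ, hF.intervalIntegral_eq, integral_const_mul,
    integral_exp_mul_Ioi (by linarith)]
  field_simp
  simp

lemma exists_bound (hF : IsBackwardSolution r h F) (t M : ℝ) :
    ∃ C, ∀ q, ∀ τ, 0 ≤ τ → τ ≤ t → ∀ x : Fin 2 → ℝ, (∀ j, 0 ≤ x j) → (∀ j, x j ≤ M) →
      |F q τ x| ≤ C := by
  have hK : IsCompact (Set.Icc (0 : ℝ) t ×ˢ Set.Icc (0 : Fin 2 → ℝ) (fun _ => M)) :=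
    isCompact_Icc.prod isCompact_Icc
  choose C hC using fun q => hK.exists_bound_of_continuousOn (hF.continuous q).continuousOn
  refine ⟨max (C 0) (C 1), fun q τ h0 h1 x hx0 hx1 => ?_⟩
  have := hC q (τ, x) ⟨⟨h0, h1⟩, hx0, hx1⟩
  rw [Real.norm_eq_abs] at this
  fin_cases q
  · exact this.trans (le_max_left _ _)
  · exact this.trans (le_max_right _ _)

end IsBackwardSolution

/-! ### Expectations along the sample paths -/

/-- The payoff `h` at time `t` if phase `n` is in progress then, and `0` otherwise. -/
noncomputable def phasePayoff (h : Fin 2 → (Fin 2 → ℝ) → ℝ) (q₀ : Fin 2) (a : Fin 2 → ℝ) (t : ℝ)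
    (d : ℕ → ℝ) (n : ℕ) : ℝ :=
  if phaseStart d n ≤ t ∧ t < phaseStart d (n + 1) then
    h (phaseStep q₀ n) (fun j => ageAtPhase q₀ a d n j + (t - phaseStart d n)) else 0

/-- The expected payoff at time `t` given the start of phase `n`, if that phase starts by
time `t`, and `0` otherwise. -/
noncomputable def phaseValue (F : Fin 2 → ℝ → (Fin 2 → ℝ) → ℝ) (q₀ : Fin 2) (a : Fin 2 → ℝ)
    (t : ℝ) (d : ℕ → ℝ) (n : ℕ) : ℝ :=
  if phaseStart d n ≤ t then
    F (phaseStep q₀ n) (t - phaseStart d n) (ageAtPhase q₀ a d n) else 0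

lemma phasePayoff_eq {h : Fin 2 → (Fin 2 → ℝ) → ℝ} {q₀ : Fin 2} {a : Fin 2 → ℝ} {t : ℝ}
    {d : ℕ → ℝ} {n : ℕ} (hd : ∀ n, 0 ≤ d n) (h1 : phaseStart d n ≤ t)
    (h2 : t < phaseStart d (n + 1)) :
    phasePayoff h q₀ a t d n = h (stateAt q₀ d t) (agesAt q₀ a d t) := by
  rw [phasePayoff, if_pos ⟨h1, h2⟩, stateAt, phaseAt_eq hd h1 h2]
  congr 1
  ext1 j
  rw [agesAt, phaseAt_eq hd h1 h2]

/-- At most one phase contributes a payoff. The total is therefore the value at the start of phase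
`n` while that start is still at or before `t`, and the realized payoff afterwards. -/
lemma sum_phasePayoff_add_phaseValue {h : Fin 2 → (Fin 2 → ℝ) → ℝ}
    {F : Fin 2 → ℝ → (Fin 2 → ℝ) → ℝ} {q₀ : Fin 2} {a : Fin 2 → ℝ} {t : ℝ} (ht : 0 ≤ t)
    {d : ℕ → ℝ} (hd : ∀ n, 0 ≤ d n) (n : ℕ) :
    ∑ k ∈ Finset.range n, phasePayoff h q₀ a t d k + phaseValue F q₀ a t d n =
      if phaseStart d n ≤ t then phaseValue F q₀ a t d n
      else h (stateAt q₀ d t) (agesAt q₀ a d t) := by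
  induction n with
  | zero => simp [phaseStart, ht]
  | succ n ih =>
    have hmono := phaseStart_mono hd (Nat.le_succ n)
    rw [Finset.sum_range_succ]
    by_cases h1 : phaseStart d n ≤ t
    · have h0 : ∑ k ∈ Finset.range n, phasePayoff h q₀ a t d k = 0 := by
        rw [if_pos h1] at ih
        linarith
      rw [h0, zero_add]
      by_cases h2 : phaseStart d (n + 1) ≤ t
      · rw [if_pos h2, phasePayoff, if_neg (fun hh => absurd h2 (not_le.2 hh.2)), zero_add]
      · rw [if_neg h2, phaseValue, if_neg h2, add_zero, phasePayoff_eq hd h1 (not_le.1 h2)]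
    · have h2 : ¬ phaseStart d (n + 1) ≤ t := fun hh => h1 (hmono.trans hh)
      rw [if_neg h1, phaseValue, if_neg h1, add_zero] at ih
      rw [if_neg h2, ih, phasePayoff, if_neg (fun hh => h1 hh.1), phaseValue, if_neg h2]
      ring

lemma exists_phase {d : ℕ → ℝ} {t : ℝ} (ht : 0 ≤ t) (hu : ∃ n, t < phaseStart d n) :
    ∃ n, phaseStart d n ≤ t ∧ t < phaseStart d (n + 1) := by
  by_contra! hcon
  obtain ⟨n, hn⟩ := hu
  have : ∀ n, phaseStart d n ≤ t := fun n => by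
    induction n with
    | zero => simpa [phaseStart] using ht
    | succ n ih => exact hcon n ih
  exact absurd (this n) (not_le.2 hn)

namespace IsBackwardSolution

variable {r : Fin 2 → ℝ} {h : Fin 2 → (Fin 2 → ℝ) → ℝ} {F : Fin 2 → ℝ → (Fin 2 → ℝ) → ℝ}

/-- Payoffs and values along paths with nonnegative durations are bounded. -/
lemma exists_path_bound (hF : IsBackwardSolution r h F) (q₀ : Fin 2) {a : Fin 2 → ℝ}
    (ha : ∀ j, 0 ≤ a j) {t : ℝ} (ht : 0 ≤ t) :
    ∃ C, ∀ d : ℕ → ℝ, (∀ n, 0 ≤ d n) → ∀ n,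
      |phasePayoff h q₀ a t d n| ≤ C ∧ |phaseValue F q₀ a t d n| ≤ C := by
  have hM : ∀ j, a j ≤ a 0 + a 1 := fun j => by
    fin_cases j
    · simpa using ha 1
    · simpa using ha 0
  obtain ⟨C, hC⟩ := hF.exists_bound t (a 0 + a 1 + t)
  have hC0 : 0 ≤ C := (abs_nonneg _).trans (hC 0 0 le_rfl ht (fun _ => 0) (fun _ => le_rfl)
    (fun _ => by linarith [ha 0, ha 1]))
  refine ⟨C, fun d hd n => ⟨?_, ?_⟩⟩
  · rw [phasePayoff]
    split_ifs with hh
    · rw [← hF.init]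
      refine hC _ _ le_rfl ht _ (fun j => ?_) (fun j => ?_)
      · linarith [ageAtPhase_nonneg (q₀ := q₀) ha hd n j]
      · linarith [ageAtPhase_le (q₀ := q₀) ha hM hd n j]
    · simpa using hC0
  · rw [phaseValue]
    split_ifs with hh
    · have h0 : 0 ≤ phaseStart d n := by
        simpa [phaseStart] using phaseStart_mono hd (Nat.zero_le n)
      refine hC _ _ (by linarith) (by linarith) _ (fun j => ageAtPhase_nonneg ha hd n j)
        (fun j => ?_)
      linarith [ageAtPhase_le (q₀ := q₀) ha hM hd n j]
    · simpa using hC0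

variable {Ω : Type*} [MeasurableSpace Ω] {P : Measure Ω} {D : ℕ → Ω → ℝ}

lemma measurable_phasePayoff (hF : IsBackwardSolution r h F) (hD : ∀ n, Measurable (D n))
    (q₀ : Fin 2) (a : Fin 2 → ℝ) (t : ℝ) (n : ℕ) :
    Measurable fun ω => phasePayoff h q₀ a t (D · ω) n := by
  refine Measurable.ite ?_ ?_ measurable_const
  · exact (measurableSet_le (measurable_phaseStart hD n) measurable_const).inter
      (measurableSet_lt measurable_const (measurable_phaseStart hD (n + 1)))
  · exact (hF.continuous_payoff _).measurable.comp (measurable_pi_lambda _ fun j =>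
      ((measurable_pi_apply j).comp (measurable_ageAtPhase hD q₀ a n)).add
        (measurable_const.sub (measurable_phaseStart hD n)))

lemma measurable_phaseValue (hF : IsBackwardSolution r h F) (hD : ∀ n, Measurable (D n))
    (q₀ : Fin 2) (a : Fin 2 → ℝ) (t : ℝ) (n : ℕ) :
    Measurable fun ω => phaseValue F q₀ a t (D · ω) n := by
  refine Measurable.ite ?_ ?_ measurable_const
  · exact measurableSet_le (measurable_phaseStart hD n) measurable_const
  · exact (hF.continuous _).measurable.comp
      ((measurable_const.sub (measurable_phaseStart hD n)).prodMk (measurable_ageAtPhase hD q₀ a n))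

/-- The one-step martingale identity. The duration of phase `n` is independent of the start data, so
Fubini integrates it out first, and that inner integral is the first-step identity. -/
lemma integral_phasePayoff_add_phaseValue [IsProbabilityMeasure P]
    (hF : IsBackwardSolution r h F) (hr : ∀ q, 0 < r q) (hD : ∀ n, Measurable (D n))
    (hi : iIndepFun D P) {q₀ : Fin 2} {a : Fin 2 → ℝ} (ha : ∀ j, 0 ≤ a j)
    (hlaw : ∀ n, HasLaw (D n) (expMeasure (r (phaseStep q₀ n))) P) {t : ℝ} (ht : 0 ≤ t) (n : ℕ) :
    ∫ ω, (phasePayoff h q₀ a t (D · ω) n + phaseValue F q₀ a t (D · ω) (n + 1)) ∂P =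
      ∫ ω, phaseValue F q₀ a t (D · ω) n ∂P := by
  set q := phaseStep q₀ n with hq
  have := isProbabilityMeasure_expMeasure (hr q)
  have hnn : ∀ᵐ ω ∂P, ∀ n, 0 ≤ D n ω :=
    ae_all_iff.2 fun n => ae_nonneg_of_hasLaw_expMeasure (hr _) (hlaw n)
  let Z : Ω → ℝ × (Fin 2 → ℝ) := fun ω => (phaseStart (D · ω) n, ageAtPhase q₀ a (D · ω) n)
  have hZ : Measurable Z := (measurable_phaseStart hD n).prodMk (measurable_ageAtPhase hD q₀ a n)
  have := Measure.isProbabilityMeasure_map hZ.aemeasurable (μ := P)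
  let φ : (ℝ × (Fin 2 → ℝ)) × ℝ → ℝ := fun p => if p.1.1 ≤ t then
    (if t - p.1.1 < p.2 then h q (fun j => p.1.2 j + (t - p.1.1)) else
      F (q + 1) (t - p.1.1 - p.2) (completeStep q fun j => p.1.2 j + p.2)) else 0
  have hφ : Measurable φ := by
    refine Measurable.ite ?_ (Measurable.ite ?_ ?_ ?_) measurable_const
    · exact measurableSet_le (by fun_prop) measurable_const
    · exact measurableSet_lt (by fun_prop) (by fun_prop)
    · have : Measurable fun p : (ℝ × (Fin 2 → ℝ)) × ℝ => fun j => p.1.2 j + (t - p.1.1) := by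
        fun_prop
      exact (hF.continuous_payoff q).measurable.comp this
    · refine (hF.continuous (q + 1)).measurable.comp (Measurable.prodMk (by fun_prop) ?_)
      have : Measurable fun p : (ℝ × (Fin 2 → ℝ)) × ℝ => fun j => p.1.2 j + p.2 := by fun_prop
      exact (continuous_completeStep q).measurable.comp this
  have hpath : ∀ᵐ ω ∂P, phasePayoff h q₀ a t (D · ω) n + phaseValue F q₀ a t (D · ω) (n + 1) =
      φ (Z ω, D n ω) := by
    filter_upwards [hnn] with ω hω
    have hs := phaseStart_succ (D · ω) n
    have h0 := hω n
    simp only [phasePayoff, phaseValue, φ, Z, hs]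
    by_cases h1 : phaseStart (D · ω) n ≤ t
    · by_cases h2 : t - phaseStart (D · ω) n < D n ω
      · rw [if_pos ⟨h1, by linarith⟩, if_neg (by linarith), if_pos h1, if_pos h2, add_zero]
      · rw [if_neg (fun hh => h2 (by linarith [hh.2])), if_pos (by linarith), if_pos h1,
          if_neg h2, zero_add, sub_sub]
        rfl
    -- A phase starting after `t` contributes nothing, and since durations are nonnegative neither
    -- does the next one.
    · rw [if_neg (fun hh => h1 hh.1), if_neg (fun hh => h1 (by linarith)), if_neg h1, add_zero]
  obtain ⟨C, hC⟩ := hF.exists_path_bound q₀ ha ht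
  have hlaw2 : P.map (fun ω => (Z ω, D n ω)) = (P.map Z).prod (expMeasure (r q)) := by
    rw [← (hlaw n).map_eq]
    exact (indepFun_iff_map_prod_eq_prod_map_map hZ.aemeasurable (hD n).aemeasurable).1
      (indepFun_phaseStart_ageAtPhase hD hi q₀ a n)
  have hZD : Measurable fun ω => (Z ω, D n ω) := hZ.prodMk (hD n)
  have hint : Integrable φ ((P.map Z).prod (expMeasure (r q))) := by
    rw [← hlaw2, integrable_map_measure hφ.aestronglyMeasurable hZD.aemeasurable]
    refine Integrable.of_bound (hφ.comp hZD).aestronglyMeasurable (C + C) ?_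
    filter_upwards [hpath, hnn] with ω h1 h2
    rw [Function.comp_apply, ← h1, Real.norm_eq_abs]
    exact (abs_add_le _ _).trans (add_le_add (hC _ h2 n).1 (hC _ h2 (n + 1)).2)
  rw [integral_congr_ae hpath, ← integral_map (f := φ) hZD.aemeasurable hφ.aestronglyMeasurable,
    hlaw2, integral_prod _ hint]
  have hinner : ∀ z : ℝ × (Fin 2 → ℝ), ∫ y, φ (z, y) ∂expMeasure (r q) =
      if z.1 ≤ t then F q (t - z.1) z.2 else 0 := by
    intro z
    by_cases hz : z.1 ≤ t
    · simp only [φ, if_pos hz]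
      exact hF.integral_expMeasure_eq (hr q) (by linarith) z.2
    · simp [φ, if_neg hz]
  simp_rw [hinner]
  rw [integral_map hZ.aemeasurable]
  · rfl
  · refine (Measurable.ite (measurableSet_le measurable_fst measurable_const) ?_
      measurable_const).aestronglyMeasurable
    have : Measurable fun z : ℝ × (Fin 2 → ℝ) => (t - z.1, z.2) := by fun_prop
    exact (hF.continuous q).measurable.comp this

/-- A solution of the backward equation gives the expected payoff. -/
theorem integrable_and_integral_eq [IsProbabilityMeasure P]
    (hF : IsBackwardSolution r h F) (hr : ∀ q, 0 < r q) (hD : ∀ n, Measurable (D n))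
    (hi : iIndepFun D P) {q₀ : Fin 2} {a : Fin 2 → ℝ} (ha : ∀ j, 0 ≤ a j)
    (hlaw : ∀ n, HasLaw (D n) (expMeasure (r (phaseStep q₀ n))) P) {t : ℝ} (ht : 0 ≤ t) :
    Integrable (fun ω => h (stateAt q₀ (D · ω) t) (agesAt q₀ a (D · ω) t)) P ∧
      ∫ ω, h (stateAt q₀ (D · ω) t) (agesAt q₀ a (D · ω) t) ∂P = F q₀ t a := by
  have hnn : ∀ᵐ ω ∂P, ∀ n, 0 ≤ D n ω :=
    ae_all_iff.2 fun n => ae_nonneg_of_hasLaw_expMeasure (hr _) (hlaw n)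
  have hR : ∀ q, r q ≤ max (r 0) (r 1) := fun q => by
    fin_cases q
    · exact le_max_left _ _
    · exact le_max_right _ _
  have hunb := ae_exists_lt_phaseStart hD hi (fun n => hr (phaseStep q₀ n)) (fun n => hR _) hlaw
  obtain ⟨C, hC⟩ := hF.exists_path_bound q₀ ha ht
  have hU := fun n => hF.measurable_phasePayoff hD q₀ a t n
  have hW := fun n => hF.measurable_phaseValue hD q₀ a t n
  have hUi : ∀ n, Integrable (fun ω => phasePayoff h q₀ a t (D · ω) n) P := fun n =>
    Integrable.of_bound (hU n).aestronglyMeasurable C (hnn.mono fun ω hω => (hC _ hω n).1)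
  have hWi : ∀ n, Integrable (fun ω => phaseValue F q₀ a t (D · ω) n) P := fun n =>
    Integrable.of_bound (hW n).aestronglyMeasurable C (hnn.mono fun ω hω => (hC _ hω n).2)
  -- Constant in expectation, bounded by `C`, and almost surely eventually equal to the payoff at
  -- time `t`.
  let Y : ℕ → Ω → ℝ := fun n ω =>
    ∑ k ∈ Finset.range n, phasePayoff h q₀ a t (D · ω) k + phaseValue F q₀ a t (D · ω) n
  have hY : ∀ n, Measurable (Y n) := fun n =>
    (Finset.measurable_sum _ fun k _ => hU k).add (hW n)
  have hYint : ∀ n, ∫ ω, Y n ω ∂P = F q₀ t a := by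
    intro n
    induction n with
    | zero => simp [Y, phaseValue, phaseStart, ht, ageAtPhase, phaseStep]
    | succ n ih =>
      rw [← ih]
      have hsum := integrable_finsetSum (Finset.range n) fun k _ => hUi k
      simp only [Y, Finset.sum_range_succ, add_assoc]
      have hUW : Integrable (fun ω => phasePayoff h q₀ a t (D · ω) n +
        phaseValue F q₀ a t (D · ω) (n + 1)) P := (hUi n).add (hWi (n + 1))
      rw [integral_add hsum hUW, integral_add hsum (hWi n),
        hF.integral_phasePayoff_add_phaseValue hr hD hi ha hlaw ht n]
  have hX : ∀ᵐ ω ∂P, |h (stateAt q₀ (D · ω) t) (agesAt q₀ a (D · ω) t)| ≤ C := by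
    filter_upwards [hnn, hunb] with ω h1 h2
    obtain ⟨n, hn1, hn2⟩ := exists_phase ht (h2 t)
    rw [← phasePayoff_eq (h := h) (q₀ := q₀) (a := a) h1 hn1 hn2]
    exact (hC _ h1 n).1
  have hlim : ∀ᵐ ω ∂P, Tendsto (fun n => Y n ω) atTop
      (𝓝 (h (stateAt q₀ (D · ω) t) (agesAt q₀ a (D · ω) t))) := by
    filter_upwards [hnn, hunb] with ω h1 h2
    obtain ⟨n, hn⟩ := h2 t
    refine tendsto_const_nhds.congr' ?_
    filter_upwards [eventually_ge_atTop n] with m hm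
    have : ¬ phaseStart (D · ω) m ≤ t := not_le.2 (hn.trans_le (phaseStart_mono h1 hm))
    simp only [Y, sum_phasePayoff_add_phaseValue ht h1, if_neg this]
  have hYC : ∀ n, ∀ᵐ ω ∂P, ‖Y n ω‖ ≤ C := fun n => by
    filter_upwards [hnn, hX] with ω h1 h2
    simp only [Y, sum_phasePayoff_add_phaseValue ht h1, Real.norm_eq_abs]
    split_ifs
    · exact (hC _ h1 n).2
    · exact h2
  -- Measurability of the payoff is inherited from the `Y n`, bypassing the supremum in `phaseAt`.
  refine ⟨Integrable.of_bound (aestronglyMeasurable_of_tendsto_ae atTop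
    (fun n => (hY n).aestronglyMeasurable) hlim) C hX, ?_⟩
  have h1 := tendsto_integral_of_dominated_convergence (fun _ => C)
    (fun n => (hY n).aestronglyMeasurable) (integrable_const C) hYC hlim
  simp only [hYint] at h1
  exact (tendsto_nhds_unique h1 tendsto_const_nhds)

end IsBackwardSolution

/-! ### First-order linear filters -/

/-- The solution of `y' = l (f - y)`, `y 0 = 0`. -/
noncomputable def expFilter (l : ℝ) (f : ℝ → ℝ) (t : ℝ) : ℝ :=
  Real.exp (-(l * t)) * ∫ s in (0 : ℝ)..t, l * Real.exp (l * s) * f s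

lemma hasDerivAt_exp_neg_mul (l t : ℝ) :
    HasDerivAt (fun t => Real.exp (-(l * t))) (-(l * Real.exp (-(l * t)))) t := by
  have h := (((hasDerivAt_id t).const_mul l).neg).exp
  refine h.congr_deriv ?_
  simp [mul_comm]

lemma expFilter_zero (l : ℝ) (f : ℝ → ℝ) : expFilter l f 0 = 0 := by simp [expFilter]

lemma hasDerivAt_expFilter (l : ℝ) {f : ℝ → ℝ} (hf : Continuous f) (t : ℝ) :
    HasDerivAt (expFilter l f) (l * (f t - expFilter l f t)) t := by
  have hc : Continuous fun s => l * Real.exp (l * s) * f s := by fun_prop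
  have h1 := hc.integral_hasStrictDerivAt 0 t |>.hasDerivAt
  refine ((hasDerivAt_exp_neg_mul l t).mul h1).congr_deriv ?_
  have h2 : Real.exp (-(l * t)) * Real.exp (l * t) = 1 := by
    rw [← Real.exp_add, neg_add_cancel, Real.exp_zero]
  rw [expFilter]
  linear_combination l * f t * h2

lemma continuous_expFilter (l : ℝ) {f : ℝ → ℝ} (hf : Continuous f) :
    Continuous (expFilter l f) :=
  continuous_iff_continuousAt.2 fun t => (hasDerivAt_expFilter l hf t).continuousAt

lemma tendsto_exp_neg_mul {l : ℝ} (hl : 0 < l) :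
    Tendsto (fun t => Real.exp (-(l * t))) atTop (𝓝 0) :=
  Real.tendsto_exp_neg_atTop_nhds_zero.comp (tendsto_id.const_mul_atTop hl)

/-- Input before a time `N` leaves a fixed multiple of `exp (-(l * t))`; input after `N` is at most
`ε / 2`, and the filter does not amplify it. -/
lemma tendsto_expFilter {l : ℝ} (hl : 0 < l) {f : ℝ → ℝ} (hf : Continuous f)
    (h0 : Tendsto f atTop (𝓝 0)) : Tendsto (expFilter l f) atTop (𝓝 0) := by
  rw [Metric.tendsto_atTop] at h0 ⊢
  intro ε hε
  obtain ⟨N, hN⟩ := h0 (ε / 2) (by positivity)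
  have hc : Continuous fun s => l * Real.exp (l * s) * f s := by fun_prop
  set I := ∫ s in (0 : ℝ)..N, l * Real.exp (l * s) * f s with hI
  have h1 := (tendsto_exp_neg_mul hl).mul_const |I|
  rw [zero_mul, Metric.tendsto_atTop] at h1
  obtain ⟨N', hN'⟩ := h1 (ε / 2) (by positivity)
  refine ⟨max N N', fun t ht => ?_⟩
  have htN := (le_max_left N N').trans ht
  have h2 := hN' t ((le_max_right N N').trans ht)
  rw [Real.dist_eq, sub_zero, abs_mul, abs_abs, Real.abs_exp] at h2
  have hint : ∫ s in N..t, l * Real.exp (l * s) * (ε / 2) =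
      (Real.exp (l * t) - Real.exp (l * N)) * (ε / 2) := by
    rw [intervalIntegral.integral_mul_const, intervalIntegral.integral_eq_sub_of_hasDerivAt
      (f := fun s => Real.exp (l * s))]
    · intro s _
      refine (((hasDerivAt_id s).const_mul l).exp).congr_deriv ?_
      simp [mul_comm]
    · exact (by fun_prop : Continuous fun s => l * Real.exp (l * s)).intervalIntegrable _ _
  have h3 : |∫ s in N..t, l * Real.exp (l * s) * f s| ≤ Real.exp (l * t) * (ε / 2) := by
    have := intervalIntegral.norm_integral_le_of_norm_le htN
      (f := fun s => l * Real.exp (l * s) * f s) (g := fun s => l * Real.exp (l * s) * (ε / 2))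
      (μ := volume) (Eventually.of_forall fun s hs => ?_)
      ((by fun_prop : Continuous fun s => l * Real.exp (l * s) * (ε / 2)).intervalIntegrable _ _)
    · rw [hint] at this
      refine this.trans ?_
      gcongr
      linarith [Real.exp_pos (l * N)]
    · have := (hN s hs.1.le).le
      rw [Real.dist_eq, sub_zero] at this
      rw [norm_mul, Real.norm_eq_abs, Real.norm_eq_abs, abs_of_pos (by positivity)]
      gcongr
  have h4 : Real.exp (-(l * t)) * Real.exp (l * t) = 1 := by
    rw [← Real.exp_add, neg_add_cancel, Real.exp_zero]
  rw [Real.dist_eq, sub_zero, expFilter, ← intervalIntegral.integral_add_adjacent_intervals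
    (hc.intervalIntegrable 0 N) (hc.intervalIntegrable N t), ← hI, abs_mul, Real.abs_exp]
  calc Real.exp (-(l * t)) * |I + ∫ s in N..t, l * Real.exp (l * s) * f s|
      ≤ Real.exp (-(l * t)) * (|I| + Real.exp (l * t) * (ε / 2)) := by
        gcongr
        exact (abs_add_le _ _).trans (by gcongr)
    _ = Real.exp (-(l * t)) * |I| + ε / 2 := by linear_combination (ε / 2) * h4
    _ < ε := by linarith

/-! ### The distribution of the step in progress -/

/-- The probability that step `k` is in progress a time `τ` after step `q` starts, when the steps
alternate at rates `r`. -/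
noncomputable def stepProb (r : Fin 2 → ℝ) (k q : Fin 2) (τ : ℝ) : ℝ :=
  r (k + 1) / (r 0 + r 1) +
    Real.exp (-((r 0 + r 1) * τ)) * ((if q = k then 1 else 0) - r (k + 1) / (r 0 + r 1))

/-- The two-state chain relaxes to equilibrium at rate `r 0 + r 1`. The index `k + 1`, taken modulo
2, is the other step. -/
lemma isBackwardSolution_stepProb {r : Fin 2 → ℝ} (hr : ∀ q, 0 < r q) (k : Fin 2) :
    IsBackwardSolution r (fun q _ => if q = k then 1 else 0) (fun q τ _ => stepProb r k q τ) where
  continuous q := by unfold stepProb; fun_prop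
  init q x := by simp [stepProb]
  hasDerivAt q τ x s := by
    have hL : r 0 + r 1 ≠ 0 := (add_pos (hr 0) (hr 1)).ne'
    have h1 : HasDerivAt (fun s => Real.exp (-((r 0 + r 1) * (τ - s))))
        ((r 0 + r 1) * Real.exp (-((r 0 + r 1) * (τ - s)))) s := by
      refine (hasDerivAt_exp_neg_mul (r 0 + r 1) (τ - s)).comp s
        ((hasDerivAt_id s).const_sub τ) |>.congr_deriv ?_
      ring
    refine ((h1.mul_const ((if q = k then 1 else 0) - r (k + 1) / (r 0 + r 1))).const_add
      (r (k + 1) / (r 0 + r 1))).congr_deriv ?_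
    unfold stepProb
    fin_cases q <;> fin_cases k <;> simp <;> field_simp <;> ring

lemma tendsto_stepProb {r : Fin 2 → ℝ} (hr : ∀ q, 0 < r q) (k q : Fin 2) :
    Tendsto (stepProb r k q) atTop (𝓝 (r (k + 1) / (r 0 + r 1))) := by
  have := ((tendsto_exp_neg_mul (add_pos (hr 0) (hr 1))).mul_const
    ((if q = k then 1 else 0) - r (k + 1) / (r 0 + r 1))).const_add (r (k + 1) / (r 0 + r 1))
  simpa [stepProb, Function.comp_def] using! this

/-! ### The expected age at the monitor

The expected age a time `τ` after step `q` starts is affine in the ages `(x₀, x₁)` at the start of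
that step. The coefficient of `x₀` is the probability that no update has been delivered yet, that of
`x₁` is the probability that exactly one has been. -/

/-- The probability that there is no delivery within time `τ` from the start of step `q`. -/
noncomputable def noDelivery (r : Fin 2 → ℝ) (q : Fin 2) (τ : ℝ) : ℝ :=
  if q = 0 then Real.exp (-(r 0 * τ)) + expFilter (r 0) (fun τ => Real.exp (-(r 1 * τ))) τ
  else Real.exp (-(r 1 * τ))

/-- The probability that there is exactly one delivery within time `τ` from the start of
step `q`. -/
noncomputable def oneDelivery (r : Fin 2 → ℝ) (q : Fin 2) (τ : ℝ) : ℝ :=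
  if q = 0 then expFilter (r 0) (expFilter (r 1) (noDelivery r 0)) τ
  else expFilter (r 1) (noDelivery r 0) τ

/-- An antiderivative of
`-(r 1 * (noDelivery r 0 + oneDelivery r 0) + r 0 * (noDelivery r 1 + oneDelivery r 1))`. -/
noncomputable def deliveryPotential (r : Fin 2 → ℝ) (τ : ℝ) : ℝ :=
  (r 0 + r 1) * (2 * noDelivery r 1 τ / r 1 + noDelivery r 0 τ / r 0 + oneDelivery r 1 τ / r 1) +
    r 1 / r 0 * (noDelivery r 0 τ + oneDelivery r 0 τ)

/-- The difference between the expected ages from the two steps, with initial ages `0`. -/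
noncomputable def freshAgeDiff (r : Fin 2 → ℝ) : ℝ → ℝ :=
  expFilter (r 0 + r 1) fun τ => (noDelivery r 0 τ + oneDelivery r 0 τ -
    (noDelivery r 1 τ + oneDelivery r 1 τ)) / (r 0 + r 1)

/-- The expected age at the monitor a time `τ` after step `q` starts with ages `0`. -/
noncomputable def freshAge (r : Fin 2 → ℝ) (q : Fin 2) (τ : ℝ) : ℝ :=
  (deliveryPotential r 0 - deliveryPotential r τ +
    (if q = 0 then r 0 else -r 1) * freshAgeDiff r τ) / (r 0 + r 1)

/-- The expected age at the monitor a time `τ` after step `q` starts with ages `x`. -/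
noncomputable def expectedAge (r : Fin 2 → ℝ) (q : Fin 2) (τ : ℝ) (x : Fin 2 → ℝ) : ℝ :=
  freshAge r q τ + noDelivery r q τ * x 0 + oneDelivery r q τ * x 1

/-! ### Differential equations and limits of the age coefficients -/

section ODE

variable (r : Fin 2 → ℝ) (τ : ℝ)

lemma hasDerivAt_noDelivery_one :
    HasDerivAt (noDelivery r 1) (-(r 1 * noDelivery r 1 τ)) τ :=
  hasDerivAt_exp_neg_mul (r 1) τ

lemma hasDerivAt_noDelivery_zero :
    HasDerivAt (noDelivery r 0) (r 0 * (noDelivery r 1 τ - noDelivery r 0 τ)) τ := by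
  refine ((hasDerivAt_exp_neg_mul (r 0) τ).add (hasDerivAt_expFilter (r 0)
    (f := fun τ => Real.exp (-(r 1 * τ))) (by fun_prop) τ)).congr_deriv ?_
  simp only [noDelivery, if_true, one_ne_zero, if_false]
  ring

lemma continuous_noDelivery (q : Fin 2) : Continuous (noDelivery r q) := by
  refine continuous_iff_continuousAt.2 fun τ => ?_
  fin_cases q
  · exact (hasDerivAt_noDelivery_zero r τ).continuousAt
  · exact (hasDerivAt_noDelivery_one r τ).continuousAt

lemma hasDerivAt_oneDelivery_one :
    HasDerivAt (oneDelivery r 1) (r 1 * (noDelivery r 0 τ - oneDelivery r 1 τ)) τ :=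
  hasDerivAt_expFilter (r 1) (continuous_noDelivery r 0) τ

lemma hasDerivAt_oneDelivery_zero :
    HasDerivAt (oneDelivery r 0) (r 0 * (oneDelivery r 1 τ - oneDelivery r 0 τ)) τ :=
  hasDerivAt_expFilter (r 0) (continuous_expFilter (r 1) (continuous_noDelivery r 0)) τ

lemma continuous_oneDelivery (q : Fin 2) : Continuous (oneDelivery r q) := by
  refine continuous_iff_continuousAt.2 fun τ => ?_
  fin_cases q
  · exact (hasDerivAt_oneDelivery_zero r τ).continuousAt
  · exact (hasDerivAt_oneDelivery_one r τ).continuousAt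

lemma continuous_freshAgeDiff : Continuous (freshAgeDiff r) := by
  have := continuous_noDelivery r
  have := continuous_oneDelivery r
  exact continuous_expFilter _ (by fun_prop)

lemma continuous_deliveryPotential : Continuous (deliveryPotential r) := by
  have := continuous_noDelivery r
  have := continuous_oneDelivery r
  unfold deliveryPotential
  fun_prop

lemma continuous_freshAge (q : Fin 2) : Continuous (freshAge r q) := by
  have := continuous_freshAgeDiff r
  have := continuous_deliveryPotential r
  unfold freshAge
  fun_prop

variable {r}

/-- A relation `y' = l * (f - y)` reads `y = f - y' / l`, so each delivery probability integrates to
a combination of itself and the earlier ones in the chain; the potential collects these. -/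
lemma hasDerivAt_deliveryPotential (hr : ∀ q, 0 < r q) :
    HasDerivAt (deliveryPotential r) (-(r 1 * (noDelivery r 0 τ + oneDelivery r 0 τ) +
      r 0 * (noDelivery r 1 τ + oneDelivery r 1 τ))) τ := by
  have h0 := (hr 0).ne'
  have h1 := (hr 1).ne'
  refine (((((hasDerivAt_noDelivery_one r τ).const_mul 2).div_const (r 1)).add
    ((hasDerivAt_noDelivery_zero r τ).div_const (r 0))).add
    ((hasDerivAt_oneDelivery_one r τ).div_const (r 1)) |>.const_mul (r 0 + r 1)).add
    (((hasDerivAt_noDelivery_zero r τ).add (hasDerivAt_oneDelivery_zero r τ)).const_mul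
      (r 1 / r 0)) |>.congr_deriv ?_
  field_simp
  ring

/-- In the sum of the two fresh ages with weights `r 1` and `r 0` the exchange terms cancel, leaving
the drop of `deliveryPotential`. Their difference relaxes at rate `r 0 + r 1` and is `freshAgeDiff`.
`freshAge` inverts this change of variables. -/
lemma hasDerivAt_freshAge (hr : ∀ q, 0 < r q) (q : Fin 2) :
    HasDerivAt (freshAge r q) (noDelivery r q τ + oneDelivery r q τ +
      r q * (freshAge r (q + 1) τ - freshAge r q τ)) τ := by
  have hL : r 0 + r 1 ≠ 0 := (add_pos (hr 0) (hr 1)).ne'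
  have hd : HasDerivAt (freshAgeDiff r) (noDelivery r 0 τ + oneDelivery r 0 τ -
      (noDelivery r 1 τ + oneDelivery r 1 τ) - (r 0 + r 1) * freshAgeDiff r τ) τ := by
    have := continuous_noDelivery r
    have := continuous_oneDelivery r
    refine (hasDerivAt_expFilter (r 0 + r 1) (f := fun τ => (noDelivery r 0 τ + oneDelivery r 0 τ -
      (noDelivery r 1 τ + oneDelivery r 1 τ)) / (r 0 + r 1)) (by fun_prop) τ).congr_deriv ?_
    rw [mul_sub, mul_div_cancel₀ _ hL, freshAgeDiff]
  refine ((((hasDerivAt_deliveryPotential τ hr).const_sub (deliveryPotential r 0)).add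
    (hd.const_mul (if q = 0 then r 0 else -r 1))).div_const (r 0 + r 1)).congr_deriv ?_
  unfold freshAge
  fin_cases q <;> simp <;> field_simp <;> ring

/-- Comparing the coefficients of `1`, `x 0` and `x 1` turns the backward equation into the
differential equations above; ageing produces the source `noDelivery + oneDelivery`. -/
lemma isBackwardSolution_expectedAge (hr : ∀ q, 0 < r q) :
    IsBackwardSolution r (fun _ x => x 0) (expectedAge r) where
  continuous q := by
    have := continuous_noDelivery r
    have := continuous_oneDelivery r
    have := continuous_freshAge r
    unfold expectedAge
    fun_prop
  init q x := by
    fin_cases q <;> simp [expectedAge, freshAge, freshAgeDiff, noDelivery, oneDelivery,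
      expFilter_zero]
  hasDerivAt q τ x s := by
    have hsub : HasDerivAt (fun s => τ - s) (-1) s := (hasDerivAt_id s).const_sub τ
    have hadd : ∀ j, HasDerivAt (fun s => x j + s) 1 s := fun j => (hasDerivAt_id s).const_add (x j)
    have hf := (hasDerivAt_freshAge (τ - s) hr q).comp s hsub
    fin_cases q
    · refine ((hf.add (((hasDerivAt_noDelivery_zero r (τ - s)).comp s hsub).mul (hadd 0))).add
        (((hasDerivAt_oneDelivery_zero r (τ - s)).comp s hsub).mul (hadd 1))).congr_deriv ?_
      simp [expectedAge, completeStep]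
      ring
    · refine ((hf.add (((hasDerivAt_noDelivery_one r (τ - s)).comp s hsub).mul (hadd 0))).add
        (((hasDerivAt_oneDelivery_one r (τ - s)).comp s hsub).mul (hadd 1))).congr_deriv ?_
      simp [expectedAge, completeStep]
      ring

lemma tendsto_noDelivery (hr : ∀ q, 0 < r q) (q : Fin 2) :
    Tendsto (noDelivery r q) atTop (𝓝 0) := by
  have h1 := tendsto_exp_neg_mul (hr 1)
  fin_cases q
  · simpa [noDelivery] using! (tendsto_exp_neg_mul (hr 0)).add
      (tendsto_expFilter (hr 0) (by fun_prop) h1)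
  · exact h1

lemma tendsto_oneDelivery (hr : ∀ q, 0 < r q) (q : Fin 2) :
    Tendsto (oneDelivery r q) atTop (𝓝 0) := by
  have h1 := tendsto_expFilter (hr 1) (continuous_noDelivery r 0) (tendsto_noDelivery hr 0)
  fin_cases q
  · exact tendsto_expFilter (hr 0) (continuous_expFilter _ (continuous_noDelivery r 0)) h1
  · exact h1

lemma tendsto_freshAge (hr : ∀ q, 0 < r q) (q : Fin 2) :
    Tendsto (freshAge r q) atTop (𝓝 (2 / r 1 + 1 / r 0 + r 1 / (r 0 * (r 0 + r 1)))) := by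
  have h0 := (hr 0).ne'
  have h1 := (hr 1).ne'
  have hL : r 0 + r 1 ≠ 0 := (add_pos (hr 0) (hr 1)).ne'
  have hn := tendsto_noDelivery hr
  have ho := tendsto_oneDelivery hr
  have cn := continuous_noDelivery r
  have co := continuous_oneDelivery r
  have hp : Tendsto (deliveryPotential r) atTop (𝓝 0) := by
    have := ((((hn 1).const_mul 2).div_const (r 1) |>.add ((hn 0).div_const (r 0)) |>.add
      ((ho 1).div_const (r 1))).const_mul (r 0 + r 1)).add
      (((hn 0).add (ho 0)).const_mul (r 1 / r 0))
    simpa [deliveryPotential] using! this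
  have hd : Tendsto (freshAgeDiff r) atTop (𝓝 0) := by
    refine tendsto_expFilter (add_pos (hr 0) (hr 1)) (by fun_prop) ?_
    simpa using (((hn 0).add (ho 0)).sub ((hn 1).add (ho 1))).div_const (r 0 + r 1)
  have := ((hp.const_sub (deliveryPotential r 0)).add
    (hd.const_mul (if q = 0 then r 0 else -r 1))).div_const (r 0 + r 1)
  -- Only the initial potential survives, with `noDelivery = 1` and `oneDelivery = 0` at time `0`,
  -- so the limit forgets `q`.
  have hv : (deliveryPotential r 0 - 0 + (if q = 0 then r 0 else -r 1) * 0) / (r 0 + r 1) =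
      2 / r 1 + 1 / r 0 + r 1 / (r 0 * (r 0 + r 1)) := by
    simp [deliveryPotential, noDelivery, oneDelivery, expFilter_zero]
    field_simp
  rw [hv] at this
  exact this

lemma tendsto_expectedAge (hr : ∀ q, 0 < r q) (q : Fin 2) (x : Fin 2 → ℝ) :
    Tendsto (fun τ => expectedAge r q τ x) atTop
      (𝓝 (2 / r 1 + 1 / r 0 + r 1 / (r 0 * (r 0 + r 1)))) := by
  have := ((tendsto_freshAge hr q).add ((tendsto_noDelivery hr q).mul_const (x 0))).add
    ((tendsto_oneDelivery hr q).mul_const (x 1))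
  simpa [expectedAge] using! this

end ODE

/-! ### The P-SIU system -/

lemma psiuDuration_measurable {Ω : Type*} [MeasurableSpace Ω] {P : Measure Ω} {μ₁ μ₂ : ℝ}
    {q₀ : Fin 2} {T : ℕ → Fin 2 → Ω → ℝ} (hT : IsPSIUExecutionTimes P μ₁ μ₂ q₀ T) (n : ℕ) :
    Measurable fun ω => psiuDuration T ω n :=
  (hT.measurable n 0).min (hT.measurable n 1)

lemma iIndepFun_psiuDuration {Ω : Type*} [MeasurableSpace Ω] {P : Measure Ω}
    [IsProbabilityMeasure P] {μ₁ μ₂ : ℝ} {q₀ : Fin 2} {T : ℕ → Fin 2 → Ω → ℝ}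
    (hT : IsPSIUExecutionTimes P μ₁ μ₂ q₀ T) : iIndepFun (fun n ω => psiuDuration T ω n) P :=
  (iIndepFun_curry hT.measurable hT.indep).comp (fun _ x => min (x 0) (x 1))
    (fun _ => (measurable_pi_apply 0).min (measurable_pi_apply 1))

lemma hasLaw_psiuDuration {Ω : Type*} [MeasurableSpace Ω] {P : Measure Ω}
    [IsProbabilityMeasure P] {μ₁ μ₂ : ℝ} (hμ₁ : 0 < μ₁) (hμ₂ : 0 < μ₂) {q₀ : Fin 2}
    {T : ℕ → Fin 2 → Ω → ℝ} (hT : IsPSIUExecutionTimes P μ₁ μ₂ q₀ T) (n : ℕ) :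
    HasLaw (fun ω => psiuDuration T ω n)
      (expMeasure (![2 * μ₁, 2 * μ₂] (phaseStep q₀ n))) P := by
  have hpos : ∀ q, 0 < ![μ₁, μ₂] q := fun q => by fin_cases q <;> simpa
  have hq : ∀ q, ![2 * μ₁, 2 * μ₂] q = ![μ₁, μ₂] q + ![μ₁, μ₂] q := fun q => by
    fin_cases q <;> simp [two_mul]
  rw [hq]
  exact hasLaw_min_expMeasure (hpos _) (hpos _) (hT.law n 0) (hT.law n 1)
    (hT.indep.indepFun (i := (n, 0)) (j := (n, 1)) (by simp))

lemma psiuSHS_isStationary_iff {μ₁ μ₂ : ℝ} (hμ₁ : 0 < μ₁) (hμ₂ : 0 < μ₂) (π : Fin 2 → ℝ) :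
    (psiuSHS μ₁ μ₂).IsStationary π ↔ π = ![μ₂ / (μ₁ + μ₂), μ₁ / (μ₁ + μ₂)] := by
  have h : μ₁ + μ₂ ≠ 0 := by positivity
  simp only [AgeSHS.IsStationary, psiuSHS, Fin.sum_univ_two, Fin.forall_fin_two]
  constructor
  -- With two states the balance equations coincide; one of them and the normalization determine
  -- `π`.
  · rintro ⟨-, hsum, h0, -⟩
    simp at h0
    ext q
    fin_cases q
    · simp
      field_simp
      linear_combination h0 / 2 + μ₂ * hsum
    · simp
      field_simp
      linear_combination -h0 / 2 + μ₁ * hsum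
  · rintro rfl
    refine ⟨⟨?_, ?_⟩, ?_, ?_, ?_⟩
    · simp; positivity
    · simp; positivity
    all_goals simp; field_simp
    ring

/-- The reset to age `0` makes the system triangular, for any `π`: it yields `v 0 1`, then `v 1 1`,
`v 0 0` and `v 1 0`. -/
lemma psiuSHS_ageBalance_iff {μ₁ μ₂ : ℝ} (hμ₁ : 0 < μ₁) (hμ₂ : 0 < μ₂) (π : Fin 2 → ℝ)
    (v : Fin 2 → Fin 2 → ℝ) :
    (psiuSHS μ₁ μ₂).AgeBalance π v ↔
      v = ![![(2 * π 0 + π 1) / (2 * μ₁), π 0 / (2 * μ₁)],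
        ![2 * (π 0 + π 1) / (2 * μ₂), (π 0 + π 1) / (2 * μ₂)]] := by
  have key : (psiuSHS μ₁ μ₂).AgeBalance π v ↔
      ((2 * μ₁ * v 0 0 = π 0 + 2 * μ₂ * v 1 1 ∧ 2 * μ₁ * v 0 1 = π 0) ∧
        2 * μ₂ * v 1 0 = π 1 + 2 * μ₁ * v 0 0 ∧ 2 * μ₂ * v 1 1 = π 1 + 2 * μ₁ * v 0 1) := by
    simp [AgeSHS.AgeBalance, psiuSHS, Fin.sum_univ_two, Fin.forall_fin_two, funext_iff]
    rfl
  rw [key, funext_iff]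
  simp only [Fin.forall_fin_two, funext_iff]
  simp
  constructor
  · rintro ⟨⟨h1, h2⟩, h3, h4⟩
    refine ⟨⟨?_, ?_⟩, ?_, ?_⟩ <;> rw [eq_div_iff (by positivity)] <;> linarith
  · rintro ⟨⟨h1, h2⟩, h3, h4⟩
    rw [h1, h2, h3, h4]
    refine ⟨⟨?_, ?_⟩, ?_, ?_⟩ <;> field_simp <;> ring

lemma pwpa_psiuNumWorking (α ρ : ℝ) (π : Fin 2 → ℝ) :
    pwpa α ρ π psiuNumWorking = 2 * (ρ ^ α * π 0 + π 1) := by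
  have h : ∀ q i, psiuNumWorking q i = if q = i then 2 else 0 := by decide
  simp [pwpa, avgWorking, h]
  ring

theorem mainTheorem4 {Ω : Type*} [MeasurableSpace Ω] (P : Measure Ω) [IsProbabilityMeasure P]
    (μ₁ μ₂ ρ α : ℝ) (hμ₁ : 0 < μ₁) (hμ₂ : 0 < μ₂) (hρ : ρ = μ₁ / μ₂)
    (q₀ : Fin 2) (a : Fin 2 → ℝ) (ha : ∀ j, 0 ≤ a j)
    (T : ℕ → Fin 2 → Ω → ℝ) (hT : IsPSIUExecutionTimes P μ₁ μ₂ q₀ T) :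
    -- the system acts like one server with independent exponential steps of rates `2μ₁`, `2μ₂`
    (iIndepFun (fun n ω => psiuDuration T ω n) P ∧
      ∀ n, HasLaw (fun ω => psiuDuration T ω n)
        (expMeasure (![2 * μ₁, 2 * μ₂] (phaseStep q₀ n))) P) ∧
    -- the average age at the monitor, as the limit of the expected age
    ((∀ t : ℝ, 0 ≤ t → Integrable (fun ω => agesAt q₀ a (psiuDuration T ω) t 0) P) ∧
      Tendsto (fun t : ℝ => ∫ ω, agesAt q₀ a (psiuDuration T ω) t 0 ∂P) atTop
        (𝓝 (1 / μ₂ * (1 + 1 / (2 * ρ) * (1 + 1 / (1 + ρ)))))) ∧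
    -- the stationary probabilities, the processor activity and the age balance equations
    ∃ π : Fin 2 → ℝ,
      (∀ π' : Fin 2 → ℝ, (psiuSHS μ₁ μ₂).IsStationary π' ↔ π' = π) ∧
      π 0 = 1 / (1 + ρ) ∧ π 1 = ρ / (1 + ρ) ∧
      (∀ q, Tendsto (fun t : ℝ => P.real {ω | stateAt q₀ (psiuDuration T ω) t = q}) atTop
        (𝓝 (π q))) ∧
      pwpa α ρ π psiuNumWorking = 2 * (ρ ^ α + ρ) / (1 + ρ) ∧
      ∃ v : Fin 2 → Fin 2 → ℝ,
        (∀ v' : Fin 2 → Fin 2 → ℝ, (psiuSHS μ₁ μ₂).AgeBalance π v' ↔ v' = v) ∧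
        (∀ q j, 0 ≤ v q j) ∧
        v 0 0 + v 1 0 = 1 / μ₂ * (1 + 1 / (2 * ρ) * (1 + 1 / (1 + ρ))) := by
  have hr : ∀ q, 0 < ![2 * μ₁, 2 * μ₂] q := fun q => by fin_cases q <;> simpa
  have hD := psiuDuration_measurable hT
  have hi := iIndepFun_psiuDuration hT
  have hlaw := hasLaw_psiuDuration hμ₁ hμ₂ hT
  have hage := fun (t : ℝ) (ht : 0 ≤ t) =>
    (isBackwardSolution_expectedAge hr).integrable_and_integral_eq hr hD hi ha hlaw ht
  have hstate := fun (k : Fin 2) (t : ℝ) (ht : 0 ≤ t) =>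
    (isBackwardSolution_stepProb hr k).integrable_and_integral_eq hr hD hi ha hlaw ht
  refine ⟨⟨hi, hlaw⟩, ⟨fun t ht => (hage t ht).1, ?_⟩, _, psiuSHS_isStationary_iff hμ₁ hμ₂,
    ?_, ?_, fun k => ?_, ?_, _, psiuSHS_ageBalance_iff hμ₁ hμ₂ _, ?_, ?_⟩
  · have hv : 1 / μ₂ * (1 + 1 / (2 * ρ) * (1 + 1 / (1 + ρ))) =
        2 / (2 * μ₂) + 1 / (2 * μ₁) + 2 * μ₂ / (2 * μ₁ * (2 * μ₁ + 2 * μ₂)) := by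
      subst hρ
      field_simp
      ring
    rw [hv]
    refine (tendsto_expectedAge hr q₀ a).congr' ?_
    filter_upwards [eventually_ge_atTop 0] with t ht
    exact (hage t ht).2.symm
  · subst hρ
    simp
    field_simp
    ring
  · subst hρ
    simp
    field_simp
    ring
  · have hv : ![μ₂ / (μ₁ + μ₂), μ₁ / (μ₁ + μ₂)] k =
        ![2 * μ₁, 2 * μ₂] (k + 1) / (![2 * μ₁, 2 * μ₂] 0 + ![2 * μ₁, 2 * μ₂] 1) := by
      fin_cases k <;> simp <;> field_simp
    rw [hv]
    refine (tendsto_stepProb hr k q₀).congr' ?_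
    filter_upwards [eventually_ge_atTop 0] with t ht
    obtain ⟨h1, h2⟩ := hstate k t ht
    have hset : {ω | stateAt q₀ (psiuDuration T ω) t = k} =
        (fun ω => if stateAt q₀ (psiuDuration T ω) t = k then (1 : ℝ) else 0) ⁻¹' {1} := by
      ext; simp
    -- Integrability of the indicator payoff makes the event null-measurable, so its probability is
    -- the integral computed above.
    have hm : NullMeasurableSet {ω | stateAt q₀ (psiuDuration T ω) t = k} P := by
      rw [hset]
      exact h1.aemeasurable.nullMeasurableSet_preimage (measurableSet_singleton 1)
    rw [← h2]
    have hind : (fun ω => if stateAt q₀ (psiuDuration T ω) t = k then (1 : ℝ) else 0) =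
        Set.indicator {ω | stateAt q₀ (psiuDuration T ω) t = k} fun _ => 1 := by
      ext; simp [Set.indicator]
    refine (congrArg (fun f => ∫ ω, f ω ∂P) hind).trans ?_
    rw [integral_indicator₀ hm]
    simp
  · rw [pwpa_psiuNumWorking]
    subst hρ
    simp
    field_simp
    ring
  · intro q j
    fin_cases q <;> fin_cases j <;> simp <;> positivity
  · subst hρ
    simp
    field_simp
    ring
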